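/- Let $X$ be a compact Hausdorff space. Let $C_p(X)$ be the vector space $C(X)$ of continuous real-valued functions on $X$ with the topology of pointwise convergence; where $C(X)$ is written without the index $p$ it is the Banach space with the supremum norm. For a set $\Gamma$ let $c_0(\Gamma)$ be the space of all $(x_\gamma)_{\gamma\in\Gamma}\in\mathbb{R}^\Gamma$ such that $\{\gamma\in\Gamma : |x_\gamma|\ge\varepsilon\}$ is finite for every $\varepsilon>0$, a Banach space with the supremum norm, and let $c_{00}(\Gamma)$ be the space of all $(x_\gamma)_{\gamma\in\Gamma}\in\mathbb{R}^\Gamma$ with $x_\gamma\neq 0$ for only finitely many $\gamma$. Write $(c_0(\Gamma))_p$ and $(c_{00}(\Gamma))_p$ for these vector spaces with the topology inherited from the product $\mathbb{R}^\Gamma$. A topological vector space $F$ contains a (closed) copy of a topological vector space $E$ if some (closed) vector subspace of $F$ is linearly homeomorphic to $E$. Then the following are equivalent. 1. There exists an uncountable family of pairwise disjoint non-empty open subsets of $X$. 2. $C_p(X)$ contains a copy of $(c_{00}(\Gamma))_p$ for some uncountable set $\Gamma$. 3. $C_p(X)$ contains a closed copy of $(c_0(\Gamma))_p$ for some uncountable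 set $\Gamma$. 4. The Banach space $C(X)$ contains a copy of the Banach space $c_0(\Gamma)$ for some uncountable set $\Gamma$. 5. $C_p(X)$ contains a compact subset that is not separable (in its subspace topology). -/

import Mathlib

open Filter Topology
open scoped ENNReal

universe u

/-- `C_p(X)`: the vector space of continuous real functions on `X`, with the topology of pointwise
convergence, that is, the subspace topology of the product `X → ℝ`. -/
def Cp (X : Type*) [TopologicalSpace X] : Submodule ℝ (X → ℝ) where
  carrier := {f | Continuous f}
  zero_mem' := continuous_zero
  add_mem' := fun hf hg => Continuous.add hf hg
  smul_mem' := fun c _ hf => Continuous.const_smul hf c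

/-- `(c₀₀(Γ))_p`: the finitely supported real families on `Γ`, with the subspace topology of the
product `Γ → ℝ`. -/
def c00p (Γ : Type*) : Submodule ℝ (Γ → ℝ) where
  carrier := {x | (Function.support x).Finite}
  zero_mem' := by simp
  add_mem' := fun hx hy => (hx.union hy).subset (Function.support_add _ _)
  smul_mem' := fun c x hx => Set.Finite.subset hx (Function.support_const_smul_subset c x)

/-- `(c₀(Γ))_p`: the real families on `Γ` that tend to `0` (for every `ε > 0` only finitely many
entries have absolute value at least `ε`), with the subspace topology of the product `Γ → ℝ`. -/
def c0p (Γ : Type*) : Submodule ℝ (Γ → ℝ) where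
  carrier := {x | Tendsto x cofinite (𝓝 0)}
  zero_mem' := tendsto_const_nhds
  add_mem' := fun hx hy => by
    have h := Tendsto.add hx hy
    rwa [add_zero] at h
  smul_mem' := fun c _ hx => by
    have h := Tendsto.const_smul hx c
    rwa [smul_zero] at h

/-- The Banach space `c₀(Γ)`: the real families on `Γ` that tend to `0`, with the supremum norm,
as a subspace of `ℓ^∞(Γ)`. -/
def c0Banach (Γ : Type*) : Submodule ℝ (lp (fun _ : Γ => ℝ) ∞) where
  carrier := {x | Tendsto (fun γ => x γ) cofinite (𝓝 0)}
  zero_mem' := tendsto_const_nhds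
  add_mem' := fun hx hy => by simpa using Tendsto.add hx hy
  smul_mem' := fun c _ hx => by simpa using Tendsto.const_smul hx c

/-- `F` contains a copy of `E`: some vector subspace of `F`, with the subspace topology, is
linearly homeomorphic to `E`. -/
def ContainsCopy (F E : Type*) [AddCommGroup F] [Module ℝ F] [TopologicalSpace F]
    [AddCommGroup E] [Module ℝ E] [TopologicalSpace E] : Prop :=
  ∃ G : Submodule ℝ F, Nonempty (E ≃L[ℝ] G)

/-- `F` contains a closed copy of `E`: some closed vector subspace of `F`, with the subspace
topology, is linearly homeomorphic to `E`. -/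
def ContainsClosedCopy (F E : Type*) [AddCommGroup F] [Module ℝ F] [TopologicalSpace F]
    [AddCommGroup E] [Module ℝ E] [TopologicalSpace E] : Prop :=
  ∃ G : Submodule ℝ F, IsClosed (G : Set F) ∧ Nonempty (E ≃L[ℝ] G)

/-!
Three arguments link the five conditions.

If `X` carries an uncountable disjoint family of nonempty open sets, bump functions `f γ` supported
in its members satisfy `f γ (p γ) = 1` at suitable points `p γ`, and the superposition
`c ↦ ∑ γ, c γ • f γ` sends null families to continuous functions (`BumpFamily.sum`). Evaluation at
the points `p γ` inverts it, so it is a closed embedding of `(c₀(Γ))_p` into `C_p(X)` and an isometry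
of `c₀(Γ)` into `C(X)`; a copy of `(c₀₀(Γ))_p` is found inside a copy of `(c₀(Γ))_p`.

A copy of `(c₀₀(Γ))_p` in `C_p(X)`, or of `c₀(Γ)` in `C(X)`, contains the images of the unit vectors.
They tend to `0` pointwise along the cofinite filter (for `c₀(Γ)` because functionals are absolutely
summable on the unit vectors), so together with `0` they form a compact set with uncountably many
isolated points (`isCompact_and_not_separableSpace_of_tendsto_cofinite`).

The remaining implication says that if `X` has the countable chain condition, then each compact
`K ⊆ C_p(X)` is separable (`separableSpace_of_countable_chain_condition`). By Namioka's theorem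
(`exists_isOpen_oscillation_le`) every nonempty open set contains a nonempty open set on which all
members of `K` oscillate by at most `ε`. A maximal disjoint family of such sets is countable and has
dense union. Choosing a point in each of its members, for `ε = 1, 1/2, 1/3, …`, gives a countable
set `D`; members of `K` that agree on `D` agree on a dense `Gδ` set, by Baire's theorem, hence
everywhere. So `K` embeds in `ℝ ^ D`. Namioka's theorem itself is reduced to countably many elements
of `K` by a Cantor scheme of open sets. For a separable `K`, two applications of compactness show
that the evaluations at points of `X` form a norm separable subset of `C(K)`, which leaves no room
for the continuum many uniformly separated branches of the scheme.
-/

/-! ### Separately continuous functions on products of compact spaces -/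

section SeparatelyContinuous

variable {X K : Type*} [TopologicalSpace X] [TopologicalSpace K] {F : X → K → ℝ}

/-- If `K` is separable, then the sections `F x` form a set of continuous functions that is compact
and metrizable for pointwise convergence, hence separable. So countably many of them suffice to tell
apart whatever points of `K` can be told apart by `F`. -/
theorem exists_countable_determining_of_separableSpace [CompactSpace X]
    [TopologicalSpace.SeparableSpace K] (hX : ∀ k, Continuous fun x => F x k)
    (hK : ∀ x, Continuous (F x)) :
    ∃ C : Set X, C.Countable ∧ ∀ k l, (∀ x ∈ C, F x k = F x l) → ∀ x, F x k = F x l := by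
  obtain ⟨D, hD, hDd⟩ := TopologicalSpace.exists_countable_dense K
  have := hD.to_subtype
  let Φ : X → D → ℝ := fun x d => F x d
  have hΦ : Continuous Φ := continuous_pi fun d => hX d
  obtain ⟨E, hEs, hEc, hEd⟩ :=
    (TopologicalSpace.IsSeparable.of_separableSpace (Set.range Φ)).exists_countable_dense_subset
  obtain ⟨C, hCc, hCE⟩ : ∃ C : Set X, C.Countable ∧ Φ '' C = E := by
    have := hEc.to_subtype
    choose g hg using fun e : E => hEs e.2
    refine ⟨Set.range g, Set.countable_range g, ?_⟩
    rw [← Set.range_comp, show Φ ∘ g = Subtype.val from funext hg, Subtype.range_coe]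
  refine ⟨C, hCc, fun k l hkl x => ?_⟩
  -- Compactness moves `x` into the closure of `C` without changing `Φ x`, hence without
  -- changing `F x`.
  have hx : Φ x ∈ Φ '' closure C := by
    rw [image_closure_of_isCompact isClosed_closure.isCompact hΦ.continuousOn, hCE]
    exact hEd ⟨x, rfl⟩
  obtain ⟨x', hx', hxx'⟩ := hx
  have hF : F x' = F x :=
    (hK x').ext_on hDd (hK x) fun d hd => congrFun hxx' ⟨d, hd⟩
  rw [← hF]
  exact closure_minimal hkl (isClosed_eq (hX k) (hX l)) hx'

/-- If `K` is separable, the sections `F x` are norm separable in `C(K)`, so a uniformly separated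
family of them is countable. -/
theorem countable_of_uniformly_separated [CompactSpace X] [CompactSpace K]
    [TopologicalSpace.SeparableSpace K] (hX : ∀ k, Continuous fun x => F x k)
    (hK : ∀ x, Continuous (F x)) {ι : Type*} {z : ι → X} {ε : ℝ} (hε : 0 < ε)
    (hz : Pairwise fun i j => ∃ k, ε ≤ |F (z i) k - F (z j) k|) : Countable ι := by
  obtain ⟨C, hC, hCF⟩ := exists_countable_determining_of_separableSpace hX hK
  have := hC.to_subtype
  -- Every section factors through the compact metrizable image `Z` of `K` in `ℝ ^ C`.
  let Ψ : K → C → ℝ := fun k x => F x k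
  have hΨ : Continuous Ψ := continuous_pi fun x => hK x
  let Z := Set.range Ψ
  have : CompactSpace Z := isCompact_iff_compactSpace.mp (isCompact_range hΨ)
  let π : C(K, Z) := ⟨Set.rangeFactorization Ψ, hΨ.subtype_mk _⟩
  have hq : IsQuotientMap π :=
    IsQuotientMap.of_surjective_continuous Set.rangeFactorization_surjective π.continuous
  have hfac : ∀ x, ∃ h : C(Z, ℝ), ∀ k, h (π k) = F x k := fun x => by
    have hx : Function.FactorsThrough (⟨F x, hK x⟩ : C(K, ℝ)) π := fun k l hkl =>
      hCF k l (fun y hy => congrFun (congrArg Subtype.val hkl) ⟨y, hy⟩) x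
    exact ⟨hq.lift _ hx, fun k => congrFun (congrArg DFunLike.coe (hq.lift_comp _ hx)) k⟩
  choose h hh using hfac
  refine Pairwise.countable_of_isOpen_disjoint (s := fun i => Metric.ball (h (z i)) (ε / 2))
    (fun i j hij => ?_) (fun _ => Metric.isOpen_ball)
    fun i => ⟨_, Metric.mem_ball_self (half_pos hε)⟩
  refine Metric.ball_disjoint_ball ?_
  obtain ⟨k, hk⟩ := hz hij
  rw [add_halves]
  refine hk.trans ?_
  rw [← hh, ← hh, ← Real.dist_eq]
  exact ContinuousMap.dist_apply_le_dist _

/-- A form of **Namioka's theorem**: every nonempty open set has a nonempty open subset on which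
`F` oscillates by at most `ε`, uniformly in the second variable. If this fails below `U`, a Cantor
scheme of open sets gives continuum many points that are uniformly separated by countably many
points of `K`, which contradicts `countable_of_uniformly_separated`. -/
theorem exists_isOpen_oscillation_le [CompactSpace X] [RegularSpace X] [CompactSpace K]
    (hX : ∀ k, Continuous fun x => F x k) (hK : ∀ x, Continuous (F x)) {ε : ℝ} (hε : 0 < ε)
    {U : Set X} (hU : IsOpen U) (hUne : U.Nonempty) :
    ∃ V ⊆ U, IsOpen V ∧ V.Nonempty ∧ ∀ x ∈ V, ∀ y ∈ V, ∀ k, |F x k - F y k| ≤ ε := by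
  by_contra! hcon
  let S := {V : Set X // V ⊆ U ∧ IsOpen V ∧ V.Nonempty}
  have split : ∀ V : S, ∃ (W : Bool → S) (k : K), (∀ b, closure (W b).1 ⊆ V.1) ∧
      ∀ x ∈ closure (W false).1, ∀ y ∈ closure (W true).1, ε / 2 ≤ |F x k - F y k| := by
    rintro ⟨V, hVU, hVo, hVne⟩
    obtain ⟨x, hx, y, hy, k, hxy⟩ := hcon V hVU hVo hVne
    have near : ∀ p ∈ V, ∃ W : S, closure W.1 ⊆ V ∧ ∀ q ∈ closure W.1, |F q k - F p k| < ε / 4 := by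
      intro p hp
      have hN : V ∩ {q | |F q k - F p k| < ε / 4} ∈ 𝓝 p := by
        refine inter_mem (hVo.mem_nhds hp) (IsOpen.mem_nhds ?_ ?_)
        · exact isOpen_lt (((hX k).sub continuous_const).abs) continuous_const
        · simpa using hε
      obtain ⟨T, hT, hTc, hTs⟩ := exists_mem_nhds_isClosed_subset hN
      have hcl : closure (interior T) ⊆ T := closure_minimal interior_subset hTc
      exact ⟨⟨interior T, interior_subset.trans (hTs.trans (Set.inter_subset_left.trans hVU)),
        isOpen_interior, p, mem_interior_iff_mem_nhds.mpr hT⟩,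
        hcl.trans (hTs.trans Set.inter_subset_left), fun q hq => (hTs (hcl hq)).2⟩
    obtain ⟨W₀, h₀V, h₀⟩ := near x hx
    obtain ⟨W₁, h₁V, h₁⟩ := near y hy
    refine ⟨fun b => bif b then W₁ else W₀, k, by rintro (_ | _) <;> assumption, ?_⟩
    intro a ha b hb
    have h2 := abs_lt.mp (h₀ a ha)
    have h3 := abs_lt.mp (h₁ b hb)
    rcases lt_abs.mp hxy with h | h
    · exact le_abs.mpr (Or.inl (by linarith))
    · exact le_abs.mpr (Or.inr (by linarith))
  choose child pt hcl hsep using split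
  let node : List Bool → S := List.rec ⟨U, subset_rfl, hU, hUne⟩ fun b _ V => child V b
  have hbranch : ∀ b : ℕ → Bool, (⋂ n, closure (node (PiNat.res b n)).1).Nonempty := fun b =>
    IsCompact.nonempty_iInter_of_sequence_nonempty_isCompact_isClosed _
      (fun n => (hcl (node (PiNat.res b n)) (b n)).trans subset_closure)
      (fun n => (node (PiNat.res b n)).2.2.2.closure) isClosed_closure.isCompact
      fun n => isClosed_closure
  choose z hz using hbranch
  -- Only the countably many points of `K` chosen at the nodes are needed to separate branches.
  let K₀ : Set K := closure (Set.range fun s => pt (node s))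
  have : CompactSpace K₀ := isCompact_iff_compactSpace.mp isClosed_closure.isCompact
  have : TopologicalSpace.SeparableSpace K₀ :=
    ⟨_, Set.countable_range fun s => (⟨pt (node s), subset_closure ⟨s, rfl⟩⟩ : K₀),
      Subtype.dense_iff.mpr (by rw [← Set.range_comp]; exact subset_rfl)⟩
  have hne : ∀ b c : ℕ → Bool, ∀ n, PiNat.res b n = PiNat.res c n → b n = false → c n = true →
      ε / 2 ≤ |F (z b) (pt (node (PiNat.res b n))) - F (z c) (pt (node (PiNat.res b n)))| := by
    intro b c n hres hb hc
    refine hsep (node (PiNat.res b n)) _ ?_ _ ?_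
    · have := Set.mem_iInter.mp (hz b) (n + 1)
      rwa [← Nat.succ_eq_add_one, PiNat.res_succ, hb] at this
    · have := Set.mem_iInter.mp (hz c) (n + 1)
      rwa [← Nat.succ_eq_add_one, PiNat.res_succ, hc, ← hres] at this
  have hcount : Countable (ℕ → Bool) := by
    refine countable_of_uniformly_separated (F := fun x (k : K₀) => F x k) (z := z)
      (fun k => hX k) (fun x => (hK x).comp continuous_subtype_val) (half_pos hε) fun b c hbc => ?_
    have hres : PiNat.res b (PiNat.firstDiff b c) = PiNat.res c (PiNat.firstDiff b c) :=
      PiNat.res_eq_res.mpr fun m hm => PiNat.apply_eq_of_lt_firstDiff hm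
    refine ⟨⟨pt (node (PiNat.res b (PiNat.firstDiff b c))), subset_closure ⟨_, rfl⟩⟩, ?_⟩
    have hd := PiNat.apply_firstDiff_ne hbc
    rcases hb : b (PiNat.firstDiff b c) with _ | _
    · exact hne b c _ hres hb (by rw [hb] at hd; simpa using hd.symm)
    · have := hne c b _ hres.symm (by rw [hb] at hd; simpa using hd.symm) hb
      rw [abs_sub_comm]
      rwa [← hres] at this
  refine (Cardinal.cantor Cardinal.aleph0).not_ge ?_
  rw [← Cardinal.mk_bool, ← Cardinal.mk_nat, Cardinal.power_def, Cardinal.mk_nat]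
  exact Cardinal.mk_le_aleph0

end SeparatelyContinuous

/-! ### Spaces with the countable chain condition -/

/-- Under the countable chain condition, any family of nonempty open sets that refines every
nonempty open set contains a countable subfamily with dense union. -/
theorem exists_countable_dense_sUnion {X : Type*} [TopologicalSpace X]
    (hccc : ∀ 𝒰 : Set (Set X), (∀ U ∈ 𝒰, IsOpen U ∧ U.Nonempty) → 𝒰.PairwiseDisjoint id →
      𝒰.Countable) {P : Set X → Prop} (hP : ∀ U, IsOpen U → U.Nonempty →
      ∃ V ⊆ U, IsOpen V ∧ V.Nonempty ∧ P V) :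
    ∃ 𝒱 : Set (Set X), 𝒱.Countable ∧ (∀ V ∈ 𝒱, IsOpen V ∧ V.Nonempty ∧ P V) ∧ Dense (⋃₀ 𝒱) := by
  obtain ⟨𝒱, h𝒱⟩ := zorn_subset
    {𝒱 : Set (Set X) | (∀ V ∈ 𝒱, IsOpen V ∧ V.Nonempty ∧ P V) ∧ 𝒱.PairwiseDisjoint id}
    fun c hc hchain => ⟨⋃₀ c, ⟨fun V ⟨s, hs, hV⟩ => (hc hs).1 V hV,
      (Set.pairwiseDisjoint_sUnion hchain.directedOn).mpr fun s hs => (hc hs).2⟩,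
      fun s hs => Set.subset_sUnion_of_mem hs⟩
  refine ⟨𝒱, hccc 𝒱 (fun V hV => ⟨(h𝒱.prop.1 V hV).1, (h𝒱.prop.1 V hV).2.1⟩) h𝒱.prop.2,
    h𝒱.prop.1, ?_⟩
  by_contra hd
  obtain ⟨V, hV, hVo, hVne, hPV⟩ := hP (closure (⋃₀ 𝒱))ᶜ isClosed_closure.isOpen_compl
    (by rwa [Set.nonempty_compl, Ne, ← dense_iff_closure_eq])
  have hdisj : ∀ W ∈ 𝒱, Disjoint V W := fun W hW =>
    Set.disjoint_left.mpr fun x hx hxW => hV hx (subset_closure ⟨W, hW, hxW⟩)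
  have hmem : V ∈ 𝒱 := h𝒱.mem_of_prop_insert
    ⟨Set.forall_mem_insert.mpr ⟨⟨hVo, hVne, hPV⟩, h𝒱.prop.1⟩,
      h𝒱.prop.2.insert fun W hW _ => hdisj W hW⟩
  exact hVne.ne_empty (disjoint_self.mp (hdisj V hmem))

/-- If `X` is compact with the countable chain condition, then every compact set of continuous
functions on `X` for the pointwise topology is separable. Namioka's theorem, the chain condition and
Baire's theorem yield a countable set of points of `X` that separates `K`, so that `K` is
metrizable. -/
theorem separableSpace_of_countable_chain_condition {X K : Type*} [TopologicalSpace X]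
    [CompactSpace X] [T2Space X] [TopologicalSpace K] [CompactSpace K]
    (hccc : ∀ 𝒰 : Set (Set X), (∀ U ∈ 𝒰, IsOpen U ∧ U.Nonempty) → 𝒰.PairwiseDisjoint id →
      𝒰.Countable) {F : X → K → ℝ} (hX : ∀ k, Continuous fun x => F x k)
    (hK : ∀ x, Continuous (F x)) (hsep : ∀ k l, (∀ x, F x k = F x l) → k = l) :
    TopologicalSpace.SeparableSpace K := by
  have hfam : ∀ n : ℕ, ∃ 𝒱 : Set (Set X), 𝒱.Countable ∧ (∀ V ∈ 𝒱, IsOpen V ∧ V.Nonempty ∧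
      ∀ x ∈ V, ∀ y ∈ V, ∀ k, |F x k - F y k| ≤ 1 / ((n : ℝ) + 1)) ∧ Dense (⋃₀ 𝒱) := fun n =>
    exists_countable_dense_sUnion hccc fun U hU hUne =>
      exists_isOpen_oscillation_le hX hK Nat.one_div_pos_of_nat hU hUne
  choose 𝒱 h𝒱c h𝒱 h𝒱d using hfam
  have hpt : ∀ n, ∀ V ∈ 𝒱 n, ∃ x, x ∈ V := fun n V hV => (h𝒱 n V hV).2.1
  choose p hp using hpt
  let D : Set X := ⋃ n, Set.range fun V : 𝒱 n => p n V V.2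
  have := fun n => (h𝒱c n).to_subtype
  have : Countable D := (Set.countable_iUnion fun n => Set.countable_range _).to_subtype
  let Ψ : K → D → ℝ := fun k x => F x k
  have hΨ : Continuous Ψ := continuous_pi fun x => hK x
  have hinj : Function.Injective Ψ := by
    intro k l hkl
    have hdense : Dense (⋂ n, ⋃₀ 𝒱 n) :=
      dense_iInter_of_isOpen (fun n => isOpen_sUnion fun V hV => (h𝒱 n V hV).1) h𝒱d
    refine hsep k l fun x => congrFun ((hX k).ext_on hdense (hX l) fun x hx => ?_) x
    refine eq_of_forall_dist_le fun ε hε => ?_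
    obtain ⟨n, hn⟩ := exists_nat_one_div_lt (half_pos hε)
    obtain ⟨V, hV, hxV⟩ := Set.mem_iInter.mp hx n
    have hk := abs_le.mp ((h𝒱 n V hV).2.2 x hxV _ (hp n V hV) k)
    have hl := abs_le.mp ((h𝒱 n V hV).2.2 x hxV _ (hp n V hV) l)
    have hkl' : F (p n V hV) k = F (p n V hV) l :=
      congrFun hkl ⟨p n V hV, Set.mem_iUnion.mpr ⟨n, ⟨V, hV⟩, rfl⟩⟩
    exact abs_le.mpr ⟨by linarith, by linarith⟩
  have := (hΨ.isClosedEmbedding hinj).isEmbedding.secondCountableTopology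
  infer_instance

/-! ### Copies of topological vector spaces as linear embeddings -/

section Copies

variable {E F : Type*} [AddCommGroup E] [Module ℝ E] [TopologicalSpace E]
  [AddCommGroup F] [Module ℝ F] [TopologicalSpace F]

/-- The linear homeomorphism of a topological vector space onto its image under a linear
embedding. -/
noncomputable def LinearMap.equivRangeOfIsEmbedding (T : E →ₗ[ℝ] F) (hT : IsEmbedding T) :
    E ≃L[ℝ] LinearMap.range T where
  toLinearEquiv := LinearEquiv.ofInjective T hT.injective
  continuous_toFun := hT.continuous.subtype_mk _
  continuous_invFun := by
    refine hT.isInducing.continuous_iff.mpr ?_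
    convert continuous_subtype_val (p := fun y => y ∈ LinearMap.range T) using 1
    exact funext fun y =>
      congrArg Subtype.val ((LinearEquiv.ofInjective T hT.injective).apply_symm_apply y)

theorem containsCopy_iff_exists_isEmbedding :
    ContainsCopy F E ↔ ∃ T : E →L[ℝ] F, IsEmbedding T := by
  constructor
  · rintro ⟨G, ⟨e⟩⟩
    exact ⟨G.subtypeL.comp e.toContinuousLinearMap,
      IsEmbedding.subtypeVal.comp e.toHomeomorph.isEmbedding⟩
  · rintro ⟨T, hT⟩
    exact ⟨_, ⟨T.toLinearMap.equivRangeOfIsEmbedding hT⟩⟩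

theorem containsClosedCopy_of_isClosedEmbedding (T : E →ₗ[ℝ] F) (hT : IsClosedEmbedding T) :
    ContainsClosedCopy F E :=
  ⟨_, T.coe_range ▸ hT.isClosed_range, ⟨T.equivRangeOfIsEmbedding hT.isEmbedding⟩⟩

theorem ContainsClosedCopy.containsCopy (h : ContainsClosedCopy F E) : ContainsCopy F E :=
  let ⟨G, _, hG⟩ := h
  ⟨G, hG⟩

end Copies

theorem c00p_le_c0p (Γ : Type*) : c00p Γ ≤ c0p Γ := fun x hx =>
  tendsto_const_nhds.congr' <| by
    filter_upwards [Set.Finite.compl_mem_cofinite (s := Function.support x) hx] with γ hγ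
    exact (Function.notMem_support.mp hγ).symm

theorem containsCopy_c00p_of_c0p {F Γ : Type*} [AddCommGroup F] [Module ℝ F] [TopologicalSpace F]
    (h : ContainsCopy F (c0p Γ)) : ContainsCopy F (c00p Γ) := by
  obtain ⟨T, hT⟩ := containsCopy_iff_exists_isEmbedding.mp h
  have hι : IsEmbedding (Submodule.inclusion (c00p_le_c0p Γ)) :=
    IsEmbedding.inclusion (c00p_le_c0p Γ)
  exact containsCopy_iff_exists_isEmbedding.mpr
    ⟨T.comp ⟨Submodule.inclusion (c00p_le_c0p Γ), hι.continuous⟩, hT.comp hι⟩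

/-! ### Bump functions on disjoint open sets -/

/-- Continuous functions `f γ` with values in `[0, 1]` and with disjoint supports, each attaining
the value `1` at a point `p γ`. The map `σ` records, for each `x`, the only index at which `f γ x`
may be nonzero; this makes sums over the family single terms. -/
structure BumpFamily (X Γ : Type*) [TopologicalSpace X] where
  f : Γ → X → ℝ
  p : Γ → X
  σ : X → Γ
  continuous : ∀ γ, Continuous (f γ)
  nonneg : ∀ γ x, 0 ≤ f γ x
  le_one : ∀ γ x, f γ x ≤ 1
  apply_p : ∀ γ, f γ (p γ) = 1
  eq_σ : ∀ γ x, f γ x ≠ 0 → γ = σ x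

namespace BumpFamily

variable {X Γ : Type*} [TopologicalSpace X]

theorem exists_of_pairwiseDisjoint [T2Space X] [CompactSpace X] [Nonempty Γ] {U : Γ → Set X}
    (hU : ∀ γ, IsOpen (U γ)) (hne : ∀ γ, (U γ).Nonempty)
    (hd : Pairwise (Function.onFun Disjoint U)) : Nonempty (BumpFamily X Γ) := by
  choose p hp using hne
  have hex : ∀ γ, ∃ f : C(X, ℝ), Set.EqOn f 0 (U γ)ᶜ ∧ Set.EqOn f 1 {p γ} ∧
      ∀ x, f x ∈ Set.Icc (0 : ℝ) 1 := fun γ =>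
    exists_continuous_zero_one_of_isClosed (hU γ).isClosed_compl isClosed_singleton
      (Set.disjoint_singleton_right.mpr fun h => h (hp γ))
  choose f hf0 hf1 hf using hex
  have hσ : ∀ x, ∃ γ₀, ∀ γ, f γ x ≠ 0 → γ = γ₀ := fun x => by
    by_cases h : ∃ γ₀, f γ₀ x ≠ 0
    · obtain ⟨γ₀, h₀⟩ := h
      have hmem : ∀ γ, f γ x ≠ 0 → x ∈ U γ := fun γ hγ => by
        by_contra hx
        exact hγ (hf0 γ hx)
      refine ⟨γ₀, fun γ hγ => ?_⟩
      by_contra hne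
      exact Set.disjoint_left.mp (hd hne) (hmem γ hγ) (hmem γ₀ h₀)
    · push Not at h
      exact ⟨Classical.arbitrary Γ, fun γ hγ => absurd (h γ) hγ⟩
  choose σ hσ using hσ
  exact ⟨⟨fun γ => f γ, p, σ, fun γ => (f γ).continuous, fun γ x => (hf γ x).1,
    fun γ x => (hf γ x).2, fun γ => hf1 γ rfl, fun γ x => hσ x γ⟩⟩

variable (B : BumpFamily X Γ)

theorem σ_p (γ : Γ) : B.σ (B.p γ) = γ :=
  (B.eq_σ γ (B.p γ) (by rw [B.apply_p]; exact one_ne_zero)).symm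

/-- The superposition `∑ γ, c γ • f γ`, as a linear function of the coefficients. -/
def sum : (Γ → ℝ) →ₗ[ℝ] (X → ℝ) where
  toFun c x := c (B.σ x) * B.f (B.σ x) x
  map_add' c d := by ext x; simp [add_mul]
  map_smul' r c := by ext x; simp [mul_assoc]

theorem sum_apply (c : Γ → ℝ) (x : X) : B.sum c x = c (B.σ x) * B.f (B.σ x) x := rfl

@[simp]
theorem sum_apply_p (c : Γ → ℝ) (γ : Γ) : B.sum c (B.p γ) = c γ := by
  rw [sum_apply, B.σ_p, B.apply_p, mul_one]

theorem abs_sum_apply_le (c : Γ → ℝ) (x : X) : |B.sum c x| ≤ |c (B.σ x)| := by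
  rw [sum_apply, abs_mul, abs_of_nonneg (B.nonneg _ _)]
  exact mul_le_of_le_one_right (abs_nonneg _) (B.le_one _ _)

theorem continuous_sum : Continuous B.sum :=
  continuous_pi fun x => (continuous_apply (B.σ x)).mul continuous_const

/-- The superposition is a uniform limit of finite sums. -/
theorem continuous_sum_apply {c : Γ → ℝ} (hc : Tendsto c cofinite (𝓝 0)) :
    Continuous (B.sum c) := by
  refine continuous_of_uniform_approx_of_continuous fun u hu => ?_
  obtain ⟨ε, hε, hεu⟩ := Metric.mem_uniformity_dist.mp hu
  have hfin : {γ | ¬ |c γ| < ε}.Finite :=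
    eventually_cofinite.mp (by simpa using hc.abs.eventually_lt_const (by simpa using hε))
  refine ⟨fun x => ∑ γ ∈ hfin.toFinset, c γ * B.f γ x,
    continuous_finsetSum _ fun γ _ => continuous_const.mul (B.continuous γ), fun x => hεu ?_⟩
  have hzero : ∀ γ, γ ≠ B.σ x → c γ * B.f γ x = 0 := fun γ hγ => by
    rw [not_imp_comm.mp (B.eq_σ γ x) hγ, mul_zero]
  change dist (B.sum c x) (∑ γ ∈ hfin.toFinset, c γ * B.f γ x) < ε
  by_cases hx : B.σ x ∈ hfin.toFinset
  · rw [Finset.sum_eq_single_of_mem _ hx fun γ _ hγ => hzero γ hγ, B.sum_apply, dist_self]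
    exact hε
  · rw [Finset.sum_eq_zero fun γ hγ => hzero γ fun h => hx (h ▸ hγ), Real.dist_eq, sub_zero]
    exact (B.abs_sum_apply_le c x).trans_lt (by simpa using hx)

/-- If a continuous function is the superposition of its values at the points `p γ`, these values
tend to `0`: where the points `p γ` with large values accumulate, the function does not vanish, so
some fixed `f γ₀` does not vanish near there. -/
theorem tendsto_cofinite_of_eq_sum [CompactSpace X] {g : X → ℝ} (hg : Continuous g)
    (h : g = B.sum (g ∘ B.p)) : Tendsto (g ∘ B.p) cofinite (𝓝 0) := by
  rw [Metric.tendsto_nhds]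
  intro ε hε
  rw [eventually_cofinite]
  by_contra hinf
  have hinf : {γ | ¬ dist ((g ∘ B.p) γ) 0 < ε}.Infinite := hinf
  set S := {γ | ¬ dist ((g ∘ B.p) γ) 0 < ε}
  have : NeBot (cofinite ⊓ 𝓟 S) := by rwa [cofinite_inf_principal_neBot_iff]
  obtain ⟨y, hy⟩ := exists_clusterPt_of_compactSpace (map B.p (cofinite ⊓ 𝓟 S))
  have hyε : ε ≤ |g y| := by
    have hcl : IsClosed {x | ε ≤ |g x|} := isClosed_le continuous_const hg.abs
    refine isClosed_iff_clusterPt.mp hcl y (hy.mono ?_)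
    refine (map_mono inf_le_right).trans ?_
    rw [map_principal, principal_mono]
    rintro _ ⟨γ, hγ, rfl⟩
    simpa [S] using hγ
  have hfy : B.f (B.σ y) y ≠ 0 := fun h0 => by
    rw [h, B.sum_apply, h0, mul_zero, abs_zero] at hyε
    exact hε.not_ge hyε
  have hN : {x | B.f (B.σ y) x ≠ 0} ∈ 𝓝 y :=
    ((B.continuous _).isOpen_preimage _ isOpen_ne).mem_nhds hfy
  have hfreq : ∃ᶠ x in map B.p (cofinite ⊓ 𝓟 S), x ∈ {x | B.f (B.σ y) x ≠ 0} :=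
    hy.frequently hN
  have hev : ∀ᶠ γ in cofinite ⊓ 𝓟 S, γ ≠ B.σ y :=
    inf_le_left (b := 𝓟 S) (Set.finite_singleton (B.σ y)).compl_mem_cofinite
  obtain ⟨γ, hγ, hne⟩ := ((frequently_map.mp hfreq).and_eventually hev).exists
  exact hne ((B.σ_p γ).symm.trans (B.eq_σ _ _ hγ).symm)

/-- Superposition embeds `(c₀(Γ))_p` into `C_p(X)`, with evaluation at the points `p γ` as a left
inverse. The range is closed because membership is a pointwise closed condition. -/
theorem containsClosedCopy_Cp [CompactSpace X] (B : BumpFamily X Γ) :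
    ContainsClosedCopy (Cp X) (c0p Γ) := by
  let T : c0p Γ →ₗ[ℝ] Cp X :=
    (B.sum.comp (c0p Γ).subtype).codRestrict (Cp X) fun c => B.continuous_sum_apply c.2
  have hTc : Continuous T := (B.continuous_sum.comp continuous_subtype_val).subtype_mk _
  let R : Cp X → Γ → ℝ := fun g γ => g.1 (B.p γ)
  have hR : Continuous R :=
    continuous_pi fun γ => (continuous_apply (B.p γ)).comp continuous_subtype_val
  have hRT : R ∘ T = Subtype.val := funext fun c => funext fun γ => B.sum_apply_p c.1 γ
  have hT : IsEmbedding T := .of_comp hTc hR (hRT ▸ IsEmbedding.subtypeVal)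
  refine containsClosedCopy_of_isClosedEmbedding T ⟨hT, ?_⟩
  have hrange : Set.range T = {g : Cp X | g.1 = B.sum (R g)} := by
    ext g
    constructor
    · rintro ⟨c, rfl⟩
      exact congrArg B.sum (congrFun hRT c).symm
    · intro hg
      exact ⟨⟨R g, B.tendsto_cofinite_of_eq_sum g.2 hg⟩, Subtype.ext hg.symm⟩
  rw [hrange]
  exact isClosed_eq continuous_subtype_val (B.continuous_sum.comp hR)

/-- Superposition is an isometric embedding of the Banach space `c₀(Γ)` into `C(X)`. -/
theorem containsCopy_continuousMap [CompactSpace X] (B : BumpFamily X Γ) :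
    ContainsCopy C(X, ℝ) (c0Banach Γ) := by
  let T : c0Banach Γ →ₗ[ℝ] C(X, ℝ) :=
    { toFun := fun c => ⟨B.sum c.1, B.continuous_sum_apply c.2⟩
      map_add' := fun c d => ContinuousMap.ext fun x => congrFun (B.sum.map_add c.1 d.1) x
      map_smul' := fun r c => ContinuousMap.ext fun x => congrFun (B.sum.map_smul r c.1) x }
  have hT : ∀ c, ‖T c‖ = ‖c‖ := fun c => by
    refine le_antisymm ?_ ?_
    · refine (ContinuousMap.norm_le _ (norm_nonneg c)).mpr fun x => ?_
      exact (B.abs_sum_apply_le c.1 x).trans (lp.norm_apply_le_norm ENNReal.top_ne_zero c.1 _)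
    · refine lp.norm_le_of_forall_le (norm_nonneg _) fun γ => ?_
      exact (congrArg norm (B.sum_apply_p c.1 γ)).ge.trans ((T c).norm_coe_le_norm (B.p γ))
  let T' : c0Banach Γ →ₗᵢ[ℝ] C(X, ℝ) := ⟨T, hT⟩
  exact containsCopy_iff_exists_isEmbedding.mpr
    ⟨T'.toContinuousLinearMap, T'.isometry.isEmbedding⟩

end BumpFamily

/-! ### Uncountable null families -/

/-- An uncountable family of pairwise distinct points that converges to a point outside the family
along the cofinite filter forms, with its limit, a compact set whose points other than the limit
are isolated. -/
theorem isCompact_and_not_separableSpace_of_tendsto_cofinite {E Γ : Type*} [TopologicalSpace E]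
    [T2Space E] [Uncountable Γ] {v : Γ → E} {a : E} (hv : Function.Injective v)
    (hva : ∀ γ, v γ ≠ a) (h : Tendsto v cofinite (𝓝 a)) :
    IsCompact (insert a (Set.range v)) ∧
      ¬ TopologicalSpace.SeparableSpace ↥(insert a (Set.range v)) := by
  refine ⟨h.isCompact_insert_range_of_cofinite, fun hsep => ?_⟩
  have hopen : ∀ γ, IsOpen {y : ↥(insert a (Set.range v)) | y.1 = v γ} := fun γ => by
    obtain ⟨N, M, hN, hM, hγN, haM, hNM⟩ := t2_separation (hva γ)
    have hfin : {γ' | v γ' ∉ M}.Finite := eventually_cofinite.mp (h (hM.mem_nhds haM))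
    have hfin' : (v '' ({γ' | v γ' ∉ M} \ {γ})).Finite := (hfin.sdiff).image v
    have hO : IsOpen (N \ v '' ({γ' | v γ' ∉ M} \ {γ})) := hN.sdiff hfin'.isClosed
    convert hO.preimage continuous_subtype_val using 1
    ext ⟨y, hy⟩
    constructor
    · rintro rfl
      exact ⟨hγN, fun ⟨γ', hγ', he⟩ => hγ'.2 (hv he)⟩
    · rintro ⟨hyN, hyv⟩
      rcases hy with rfl | ⟨γ', rfl⟩
      · exact absurd haM (Set.disjoint_left.mp hNM hyN)
      · by_contra hne
        exact hyv ⟨γ', ⟨Set.disjoint_left.mp hNM hyN, fun h => hne (congrArg v h)⟩, rfl⟩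
  have : Countable Γ := Pairwise.countable_of_isOpen_disjoint
    (fun γ γ' hne => Set.disjoint_left.mpr fun y (hy : y.1 = _) (hy' : y.1 = _) =>
      hne (hv (hy.symm.trans hy'))) hopen
    fun γ => ⟨⟨v γ, Set.mem_insert_of_mem _ ⟨γ, rfl⟩⟩, rfl⟩
  exact not_countable this

theorem exists_isCompact_not_separableSpace_of_c00p {F Γ : Type*} [AddCommGroup F] [Module ℝ F]
    [TopologicalSpace F] [T2Space F] [Uncountable Γ] (h : ContainsCopy F (c00p Γ)) :
    ∃ K : Set F, IsCompact K ∧ ¬ TopologicalSpace.SeparableSpace K := by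
  classical
  obtain ⟨T, hT⟩ := containsCopy_iff_exists_isEmbedding.mp h
  let e : Γ → c00p Γ := fun γ =>
    ⟨Pi.single γ 1, (Set.finite_singleton γ).subset Pi.support_single_subset⟩
  have he : ∀ γ γ', (e γ).1 γ' = if γ' = γ then 1 else 0 := fun γ γ' =>
    Pi.single_apply γ 1 γ'
  have hinj : Function.Injective e := fun γ γ' h => by
    have := congrFun (congrArg Subtype.val h) γ
    simpa [he] using this
  have hne : ∀ γ, e γ ≠ 0 := fun γ h => by
    have := congrFun (congrArg Subtype.val h) γ
    simp [he] at this
  have hlim : Tendsto e cofinite (𝓝 0) := by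
    refine tendsto_subtype_rng.mpr (tendsto_pi_nhds.mpr fun γ' => ?_)
    refine tendsto_const_nhds.congr' ?_
    filter_upwards [(Set.finite_singleton γ').compl_mem_cofinite] with γ hγ
    rw [he, if_neg fun h => hγ h.symm]
    rfl
  refine ⟨_, isCompact_and_not_separableSpace_of_tendsto_cofinite (hT.injective.comp hinj)
    (a := 0) (fun γ h => hne γ (hT.injective (h.trans (map_zero T).symm))) ?_⟩
  simpa using (T.continuous.tendsto 0).comp hlim

/-- The unit vectors of `c₀(Γ)` tend weakly to `0`: a continuous functional is absolutely summable
on them. -/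
theorem tendsto_cofinite_of_c0Banach {Γ : Type*} [DecidableEq Γ] (φ : c0Banach Γ →L[ℝ] ℝ)
    {e : Γ → c0Banach Γ} (he : ∀ γ γ', (e γ).1 γ' = if γ' = γ then 1 else 0) :
    Tendsto (fun γ => φ (e γ)) cofinite (𝓝 0) := by
  refine (summable_of_sum_le (f := fun γ => |φ (e γ)|) (c := ‖φ‖) (fun _ => abs_nonneg _)
    fun s => ?_).of_abs.tendsto_cofinite_zero
  -- Testing `φ` against this vector of norm at most `1` yields the partial sum of absolute values.
  let w : c0Banach Γ := ∑ γ ∈ s, (SignType.sign (φ (e γ)) : ℝ) • e γ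
  have hw : ‖w‖ ≤ 1 := by
    refine lp.norm_le_of_forall_le zero_le_one fun γ => ?_
    let ev : c0Banach Γ →ₗ[ℝ] ℝ :=
      { toFun := fun c => c.1 γ
        map_add' := fun _ _ => rfl
        map_smul' := fun _ _ => rfl }
    have hev : ∀ γ', ev (e γ') = if γ = γ' then 1 else 0 := fun γ' => he γ' γ
    change ‖ev w‖ ≤ 1
    have hval : ev w = if γ ∈ s then (SignType.sign (φ (e γ)) : ℝ) else 0 := by
      simp [w, map_sum, hev]
    rw [hval]
    split_ifs
    · rcases SignType.sign (φ (e γ)) with _ | _ | _ <;> simp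
    · simp
  calc ∑ γ ∈ s, |φ (e γ)| = φ w := by simp [w, sign_mul_self]
    _ ≤ ‖φ w‖ := le_abs_self _
    _ ≤ ‖φ‖ * ‖w‖ := φ.le_opNorm w
    _ ≤ ‖φ‖ := mul_le_of_le_one_right φ.opNorm_nonneg hw

/-- The images of the unit vectors of `c₀(Γ)` tend to `0` weakly in `C(X)`, hence pointwise. -/
theorem exists_isCompact_not_separableSpace_of_c0Banach {X Γ : Type*} [TopologicalSpace X]
    [CompactSpace X] [Uncountable Γ] (h : ContainsCopy C(X, ℝ) (c0Banach Γ)) :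
    ∃ K : Set (Cp X), IsCompact K ∧ ¬ TopologicalSpace.SeparableSpace K := by
  classical
  obtain ⟨T, hT⟩ := containsCopy_iff_exists_isEmbedding.mp h
  have hmem : ∀ γ, lp.single ∞ γ (1 : ℝ) ∈ c0Banach Γ := fun γ => by
    refine tendsto_const_nhds.congr' ?_
    filter_upwards [(Set.finite_singleton γ).compl_mem_cofinite] with γ' hγ'
    exact (lp.single_apply_ne (E := fun _ : Γ => ℝ) ∞ γ 1 hγ').symm
  let e : Γ → c0Banach Γ := fun γ => ⟨lp.single ∞ γ 1, hmem γ⟩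
  have he : ∀ γ γ', (e γ).1 γ' = if γ' = γ then 1 else 0 := fun γ γ' => Pi.single_apply γ 1 γ'
  have hinj : Function.Injective e := fun γ γ' h => by
    have := congrArg (fun c : c0Banach Γ => c.1 γ) h
    simpa [he] using this
  have hne : ∀ γ, e γ ≠ 0 := fun γ h => by
    have := congrArg (fun c : c0Banach Γ => c.1 γ) h
    rw [he, if_pos rfl] at this
    exact one_ne_zero this
  let v : Γ → Cp X := fun γ => ⟨T (e γ), (T (e γ)).continuous⟩
  have hv : ∀ (γ : Γ) (c : c0Banach Γ), (v γ).1 = T c → e γ = c := fun γ c h =>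
    hT.injective (DFunLike.coe_injective h)
  refine ⟨_, isCompact_and_not_separableSpace_of_tendsto_cofinite (v := v) (a := 0)
    (fun γ γ' h => hinj (hv γ _ (congrArg Subtype.val h))) (fun γ h => hne γ (hv γ 0 ?_)) ?_⟩
  · rw [h, T.map_zero]
    rfl
  · refine tendsto_subtype_rng.mpr (tendsto_pi_nhds.mpr fun x => ?_)
    exact tendsto_cofinite_of_c0Banach ((ContinuousMap.evalCLM ℝ x).comp T) he

/-! ### The equivalence -/

theorem mainTheorem2 (X : Type u) [TopologicalSpace X] [CompactSpace X] [T2Space X] :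
    List.TFAE [
      ∃ 𝒰 : Set (Set X), ¬ 𝒰.Countable ∧ (∀ U ∈ 𝒰, IsOpen U ∧ U.Nonempty) ∧
        𝒰.PairwiseDisjoint id,
      ∃ Γ : Type u, Uncountable Γ ∧ ContainsCopy (Cp X) (c00p Γ),
      ∃ Γ : Type u, Uncountable Γ ∧ ContainsClosedCopy (Cp X) (c0p Γ),
      ∃ Γ : Type u, Uncountable Γ ∧ ContainsCopy C(X, ℝ) (c0Banach Γ),
      ∃ K : Set (Cp X), IsCompact K ∧ ¬ TopologicalSpace.SeparableSpace K] := by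
  have bump : ∀ 𝒰 : Set (Set X), ¬ 𝒰.Countable → (∀ U ∈ 𝒰, IsOpen U ∧ U.Nonempty) →
      𝒰.PairwiseDisjoint id → Uncountable 𝒰 ∧ Nonempty (BumpFamily X 𝒰) := by
    intro 𝒰 h𝒰 hU hd
    have hunc : Uncountable 𝒰 := not_countable_iff.mp h𝒰
    exact ⟨hunc, BumpFamily.exists_of_pairwiseDisjoint (U := Subtype.val)
      (fun U => (hU U U.2).1) (fun U => (hU U U.2).2) (hd.subtype _ _)⟩
  tfae_have 1 → 3 := fun ⟨𝒰, h𝒰, hU, hd⟩ =>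
    let ⟨hunc, ⟨B⟩⟩ := bump 𝒰 h𝒰 hU hd
    ⟨𝒰, hunc, B.containsClosedCopy_Cp⟩
  tfae_have 1 → 4 := fun ⟨𝒰, h𝒰, hU, hd⟩ =>
    let ⟨hunc, ⟨B⟩⟩ := bump 𝒰 h𝒰 hU hd
    ⟨𝒰, hunc, B.containsCopy_continuousMap⟩
  tfae_have 3 → 2 := fun ⟨Γ, hΓ, h⟩ => ⟨Γ, hΓ, containsCopy_c00p_of_c0p h.containsCopy⟩
  tfae_have 2 → 5 := fun ⟨_, _, h⟩ => exists_isCompact_not_separableSpace_of_c00p h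
  tfae_have 4 → 5 := fun ⟨_, _, h⟩ => exists_isCompact_not_separableSpace_of_c0Banach h
  tfae_have 5 → 1 := by
    rintro ⟨K, hK, hsep⟩
    by_contra hccc
    have : CompactSpace K := isCompact_iff_compactSpace.mp hK
    refine hsep (separableSpace_of_countable_chain_condition (F := fun x (g : K) => g.1.1 x)
      (fun 𝒰 hU hd => ?_) (fun g => g.1.2)
      (fun x => (continuous_apply x).comp (continuous_subtype_val.comp continuous_subtype_val))
      fun g h hgh => Subtype.ext (Subtype.ext (funext hgh)))
    by_contra h𝒰
    exact hccc ⟨𝒰, h𝒰, hU, hd⟩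
  tfae_finish
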